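/- For a Hausdorff topological space $X$ let $C_b(X)$ be the space of bounded continuous functions $X\to\mathbb R$, and let the mixed topology $\tau_1^{\mathscr M}$ on $C_b(X)$ be the locally convex topology generated by the seminorms $$p_{(C_n),(a_n)}(\varphi)=\sup_{n}\, a_n\sup_{x\in C_n}|\varphi(x)|,\qquad C_n\subset X\text{ compact},\quad 0<a_n\to 0 .$$ A family $(P_t)_{t\ge0}$ of operators on $C_b(X)$ is called a $C_0$-semigroup on $(C_b(X),\tau_1^{\mathscr M})$ if $P_0\varphi=\varphi$ and $P_sP_t\varphi=P_{s+t}\varphi$ for all $s,t\ge 0$ and $\varphi\in C_b(X)$; if for all $T\ge0$, $\varepsilon>0$ and every such seminorm $p$ there are such a seminorm $q$ and $\delta>0$ with $p(P_t\varphi_1-P_t\varphi_2)<\varepsilon$ whenever $0\le t\le T$ and $q(\varphi_1-\varphi_2)<\delta$; and if $P_t\varphi\to\varphi$ in $\tau_1^{\mathscr M}$ as $t\to0$ for every $\varphi\in C_b(X)$. Let $E$ be a separable (real) Banach space with Borel $\sigma$-algebra $\mathscr B(E)$, let $(T_t)_{t\ge0}$ be a $C_0$-semigroup of bounded linear operators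 on $E$, and let $(\mu_t)_{t\ge0}$ be probability measures on $(E,\mathscr B(E))$ with $$\mu_{t+s}=(\mu_t\circ T_s^{-1})*\mu_s\qquad\text{for all } t,s\ge0 .$$ (a) Suppose that $t\mapsto\int_E\varphi\,d\mu_t$ is continuous on $[0,\infty)$ for every $\varphi\in C_b(E)$, where $E$ carries the norm topology. Then $$P_t\varphi(x)=\int_E\varphi(T_tx+y)\,\mu_t(dy),\qquad \varphi\in C_b(E),\ x\in E,\ t\ge0,$$ defines linear operators $P_t\colon C_b(E)\to C_b(E)$, and $(P_t)_{t\ge0}$ is a $C_0$-semigroup on $(C_b(E),\tau_1^{\mathscr M})$. (b) Suppose that $E$ is in addition reflexive, and let $E_{bw}$ be $E$ with the bounded weak topology, in which a set is closed if and only if its intersection with every weakly compact set is weakly closed. If $t\mapsto\int_E\varphi\,d\mu_t$ is continuous on $[0,\infty)$ for every $\varphi\in C_b(E_{bw})$, then the same formula, for $\varphi\in C_b(E_{bw})$, defines linear operators $P_t\colon C_b(E_{bw})\to C_b(E_{bw})$, and $(P_t)_{t\ge0}$ is a $C_0$-semigroup on $(C_b(E_{bw}),\tau_1^{\mathscr M})$.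 -/

import Mathlib

open MeasureTheory Filter Topology NNReal BoundedContinuousFunction

/-! ### The mixed topology on the space of bounded continuous functions -/

/-- The data of a seminorm of the mixed topology: a sequence of compact sets together with a
sequence of positive numbers tending to `0`. -/
structure MixedIndex (X : Type*) [TopologicalSpace X] where
  /-- the compact sets -/
  C : ℕ → Set X
  /-- the weights -/
  a : ℕ → ℝ
  isCompact_C : ∀ n, IsCompact (C n)
  a_pos : ∀ n, 0 < a n
  a_tendsto : Tendsto a atTop (𝓝 0)

instance MixedIndex.instNonempty (X : Type*) [TopologicalSpace X] : Nonempty (MixedIndex X) :=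
  ⟨{ C := fun _ => ∅
     a := fun n => 1 / ((n : ℝ) + 1)
     isCompact_C := fun _ => isCompact_empty
     a_pos := fun n => by positivity
     a_tendsto := tendsto_one_div_add_atTop_nhds_zero_nat }⟩

/-- `φ ↦ sup_{x ∈ C} |φ x|`, the supremum over the empty set being `0`. -/
noncomputable def supOn {X : Type*} [TopologicalSpace X] (C : Set X) (φ : X →ᵇ ℝ) : ℝ :=
  ⨆ x : C, |φ x|

/-- `φ ↦ sup_n (a_n * sup_{x ∈ C_n} |φ x|)`. -/
noncomputable def mixedSup {X : Type*} [TopologicalSpace X] (i : MixedIndex X) (φ : X →ᵇ ℝ) : ℝ :=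
  ⨆ n : ℕ, i.a n * supOn (i.C n) φ

section MixedSeminorm

variable {X : Type*} [TopologicalSpace X]

theorem supOn_bddAbove (C : Set X) (φ : X →ᵇ ℝ) : BddAbove (Set.range fun x : C => |φ x|) :=
  ⟨‖φ‖, by rintro _ ⟨x, rfl⟩; exact φ.norm_coe_le_norm x⟩

theorem supOn_nonneg (C : Set X) (φ : X →ᵇ ℝ) : 0 ≤ supOn C φ :=
  Real.iSup_nonneg fun _ => abs_nonneg _

theorem supOn_le_norm (C : Set X) (φ : X →ᵇ ℝ) : supOn C φ ≤ ‖φ‖ :=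
  Real.iSup_le (fun x => φ.norm_coe_le_norm x) (norm_nonneg φ)

theorem supOn_add_le (C : Set X) (φ ψ : X →ᵇ ℝ) : supOn C (φ + ψ) ≤ supOn C φ + supOn C ψ :=
  Real.iSup_le (fun x => (abs_add_le (φ x) (ψ x)).trans
    (add_le_add (le_ciSup (supOn_bddAbove C φ) x) (le_ciSup (supOn_bddAbove C ψ) x)))
    (add_nonneg (supOn_nonneg C φ) (supOn_nonneg C ψ))

theorem supOn_smul (C : Set X) (c : ℝ) (φ : X →ᵇ ℝ) : supOn C (c • φ) = |c| * supOn C φ := by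
  simp only [supOn, Real.mul_iSup_of_nonneg (abs_nonneg c)]
  simp [abs_mul]

theorem mixedSup_bddAbove (i : MixedIndex X) (φ : X →ᵇ ℝ) :
    BddAbove (Set.range fun n : ℕ => i.a n * supOn (i.C n) φ) := by
  obtain ⟨A, hA⟩ := i.a_tendsto.bddAbove_range
  refine ⟨A * ‖φ‖, ?_⟩
  rintro _ ⟨n, rfl⟩
  exact mul_le_mul (hA ⟨n, rfl⟩) (supOn_le_norm _ φ) (supOn_nonneg _ φ)
    ((i.a_pos n).le.trans (hA ⟨n, rfl⟩))

theorem mixedSup_nonneg (i : MixedIndex X) (φ : X →ᵇ ℝ) : 0 ≤ mixedSup i φ :=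
  Real.iSup_nonneg fun n => mul_nonneg (i.a_pos n).le (supOn_nonneg _ φ)

theorem mixedSup_add_le (i : MixedIndex X) (φ ψ : X →ᵇ ℝ) :
    mixedSup i (φ + ψ) ≤ mixedSup i φ + mixedSup i ψ := by
  refine Real.iSup_le (fun n => ?_) (add_nonneg (mixedSup_nonneg i φ) (mixedSup_nonneg i ψ))
  calc i.a n * supOn (i.C n) (φ + ψ)
      ≤ i.a n * (supOn (i.C n) φ + supOn (i.C n) ψ) :=
        mul_le_mul_of_nonneg_left (supOn_add_le _ φ ψ) (i.a_pos n).le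
    _ = i.a n * supOn (i.C n) φ + i.a n * supOn (i.C n) ψ := mul_add _ _ _
    _ ≤ mixedSup i φ + mixedSup i ψ :=
        add_le_add (le_ciSup (mixedSup_bddAbove i φ) n) (le_ciSup (mixedSup_bddAbove i ψ) n)

theorem mixedSup_smul (i : MixedIndex X) (c : ℝ) (φ : X →ᵇ ℝ) :
    mixedSup i (c • φ) = ‖c‖ * mixedSup i φ := by
  simp only [mixedSup, Real.norm_eq_abs, Real.mul_iSup_of_nonneg (abs_nonneg c), supOn_smul]
  exact iSup_congr fun n => by ring

end MixedSeminorm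

/-- The seminorm `p_{(C_n),(a_n)}` on the space of bounded continuous functions. -/
noncomputable def mixedSeminorm (X : Type*) [TopologicalSpace X] :
    SeminormFamily ℝ (X →ᵇ ℝ) (MixedIndex X) :=
  fun i => Seminorm.of (mixedSup i) (mixedSup_add_le i) (mixedSup_smul i)

/-- The mixed topology on the space of bounded continuous functions: the locally convex topology
generated by all the seminorms `p_{(C_n),(a_n)}`. -/
@[reducible]
noncomputable def mixedTopology (X : Type*) [TopologicalSpace X] : TopologicalSpace (X →ᵇ ℝ) :=
  (mixedSeminorm X).moduleFilterBasis.topology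

/-- `C_0`-semigroups on the space of bounded continuous functions with the mixed topology. -/
structure IsMixedC0Semigroup {X : Type*} [TopologicalSpace X]
    (P : ℝ≥0 → (X →ᵇ ℝ) → (X →ᵇ ℝ)) : Prop where
  map_zero : ∀ φ, P 0 φ = φ
  map_add : ∀ s t φ, P s (P t φ) = P (s + t) φ
  /-- local uniform equicontinuity -/
  equicontinuous : ∀ (T : ℝ≥0) (ε : ℝ), 0 < ε → ∀ i : MixedIndex X,
    ∃ (j : MixedIndex X) (δ : ℝ), 0 < δ ∧ ∀ t ≤ T, ∀ φ₁ φ₂ : X →ᵇ ℝ,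
      mixedSeminorm X j (φ₁ - φ₂) < δ → mixedSeminorm X i (P t φ₁ - P t φ₂) < ε
  /-- strong right continuity at `0` -/
  tendsto_zero : ∀ φ, Tendsto (fun t => P t φ) (𝓝 0) (@nhds _ (mixedTopology X) φ)

/-! ### The bounded weak topology -/

/-- A copy of `E`, to be endowed with the bounded weak topology. -/
def BWSpace (E : Type*) := E

/-- The identity map from `E` to the copy of `E` that carries the bounded weak topology. -/
def toBW {E : Type*} : E ≃ BWSpace E := Equiv.refl E

/-- The bounded weak topology: a set is closed if and only if its intersection with every weakly
compact set is weakly closed. (For reflexive `E = (E*)*` the weak topology of `E` is the weak-star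
topology of the dual of `E*`.) -/
instance BWSpace.instTopologicalSpace {E : Type*} [NormedAddCommGroup E] [NormedSpace ℝ E] :
    TopologicalSpace (BWSpace E) :=
  TopologicalSpace.ofClosed
    {A : Set (BWSpace E) | ∀ K : Set E, IsCompact (toWeakSpace ℝ E '' K) →
      IsClosed (toWeakSpace ℝ E '' (toBW ⁻¹' A ∩ K))}
    (fun K _ => by simp)
    (fun 𝒜 h𝒜 K hK => by
      rcases 𝒜.eq_empty_or_nonempty with rfl | ⟨A₀, hA₀⟩
      · simpa using hK.isClosed
      · have : toWeakSpace ℝ E '' (toBW ⁻¹' (⋂₀ 𝒜) ∩ K) =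
            ⋂ A : 𝒜, toWeakSpace ℝ E '' (toBW ⁻¹' (A : Set (BWSpace E)) ∩ K) := by
          have : Nonempty 𝒜 := ⟨⟨A₀, hA₀⟩⟩
          rw [← Set.image_iInter (toWeakSpace ℝ E).bijective, ← Set.iInter_inter,
            Set.sInter_eq_iInter, Set.preimage_iInter]
        rw [this]
        exact isClosed_iInter fun A => h𝒜 A.2 K hK)
    (fun A hA B hB K hK => by
      rw [Set.preimage_union, Set.union_inter_distrib_right, Set.image_union]
      exact (hA K hK).union (hB K hK))

/-! ### The data of a generalized Mehler semigroup -/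

/-- `C_0`-semigroups of bounded linear operators on a Banach space. -/
structure IsC0Semigroup {E : Type*} [NormedAddCommGroup E] [NormedSpace ℝ E]
    (T : ℝ≥0 → E →L[ℝ] E) : Prop where
  map_zero : T 0 = ContinuousLinearMap.id ℝ E
  map_add : ∀ s t, T (s + t) = (T s).comp (T t)
  tendsto_zero : ∀ x, Tendsto (fun t => T t x) (𝓝 0) (𝓝 x)

/-- Reflexivity: the canonical embedding into the bidual is onto. -/
def IsReflexiveSpace (E : Type*) [NormedAddCommGroup E] [NormedSpace ℝ E] : Prop :=
  Function.Surjective (NormedSpace.inclusionInDoubleDual ℝ E)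

/-! ### Abstract Mehler semigroups -/

/-! Both topologies are compactly generated, so one argument on compact sets, for `IsMehlerFamily`,
serves both cases. Its inputs are continuity of addition and of `(t, x) ↦ T t x` on compact sets,
tightness of `μ t` uniformly for `t ≤ t₀`, weak continuity of `t ↦ μ t`, and the convolution
identity.

Tightness makes `(t, x) ↦ P_t φ(x)` jointly continuous on `[0, t₀] × C` (`continuousOn_integral`).
Hence `P_t φ` is continuous and `P_t φ → φ` uniformly on compact sets; since `‖P_t φ‖ ≤ ‖φ‖`, this
is convergence in the mixed topology. For equicontinuity (`exists_mixedSup_operator_le`), the tails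
of `μ t` are cut at compact sets `K k` whose complements have mass at most `4⁻⁽ᵏ⁺¹⁾`, which leaves
room for weights decaying only like `2⁻ᵏ` on the sets `D n + K k`, where `D n` collects the orbits
of `C n`.

It remains to verify the inputs. In the norm case tightness is the converse half of Prokhorov's
theorem. In the bounded weak case balls lie in weakly compact sets by reflexivity, so tightness
means uniformly small mass outside large balls (`exists_measureReal_norm_gt_le`), and joint
continuity of the orbits follows from strong continuity of the adjoint semigroup (`sunDual_eq_top`).
-/

theorem continuous_of_continuousOn_isCompact {X Y : Type*} [TopologicalSpace X]
    [TopologicalSpace Y] [CompactlyCoherentSpace X] {f : X → Y}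
    (h : ∀ K, IsCompact K → ContinuousOn f K) : Continuous f :=
  (CompactlyCoherentSpace.isCoherentWith (X := X)).continuous_iff.2 h

theorem abs_integral_le_of_abs_le_on {X : Type*} [TopologicalSpace X] [T2Space X]
    [MeasurableSpace X] [OpensMeasurableSpace X] (μ : Measure X) [IsProbabilityMeasure μ]
    (ψ : X →ᵇ ℝ) {K : Set X} (hK : IsCompact K) {η : ℝ} (hη : 0 ≤ η) (h : ∀ y ∈ K, |ψ y| ≤ η) :
    |∫ y, ψ y ∂μ| ≤ η + ‖ψ‖ * μ.real Kᶜ := by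
  have hKm := hK.isClosed.measurableSet
  calc |∫ y, ψ y ∂μ| ≤ ∫ y, |ψ y| ∂μ := abs_integral_le_integral_abs
    _ ≤ ∫ y, (η + Kᶜ.indicator (fun _ => ‖ψ‖) y) ∂μ := by
        refine integral_mono (ψ.integrable μ).abs
          ((integrable_const _).add ((integrable_const _).indicator hKm.compl)) fun y => ?_
        by_cases hy : y ∈ K
        · simpa [hy] using h y hy
        · simpa [hy] using (ψ.norm_coe_le_norm y).trans (le_add_of_nonneg_left hη)
    _ = η + ‖ψ‖ * μ.real Kᶜ := by
        rw [integral_add (integrable_const _) ((integrable_const _).indicator hKm.compl),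
          integral_indicator_const _ hKm.compl]
        simp [mul_comm]

/-! ### Estimates for the mixed seminorms. -/

theorem supOn_le {X : Type*} [TopologicalSpace X] {C : Set X} {φ : X →ᵇ ℝ} {r : ℝ} (hr : 0 ≤ r)
    (h : ∀ x ∈ C, |φ x| ≤ r) : supOn C φ ≤ r :=
  Real.iSup_le (fun x => h x x.2) hr

theorem abs_le_supOn {X : Type*} [TopologicalSpace X] {C : Set X} (φ : X →ᵇ ℝ) {x : X}
    (hx : x ∈ C) : |φ x| ≤ supOn C φ :=
  le_ciSup (supOn_bddAbove C φ) ⟨x, hx⟩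

theorem le_mixedSup {X : Type*} [TopologicalSpace X] (i : MixedIndex X) (φ : X →ᵇ ℝ) (n : ℕ) :
    i.a n * supOn (i.C n) φ ≤ mixedSup i φ :=
  le_ciSup (mixedSup_bddAbove i φ) n

/-- Mixed seminorms of a norm bounded function are controlled by finitely many compact sets. -/
theorem mixedSup_le_of_bound {X : Type*} [TopologicalSpace X] (i : MixedIndex X) {M ε : ℝ}
    (hε : 0 < ε) : ∃ (N : ℕ) (δ : ℝ), 0 < δ ∧ ∀ φ : X →ᵇ ℝ, ‖φ‖ ≤ M →
      (∀ n < N, ∀ x ∈ i.C n, |φ x| ≤ δ) → mixedSup i φ ≤ ε := by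
  have hlim : Tendsto (fun n => i.a n * M) atTop (𝓝 0) := by
    simpa using i.a_tendsto.mul_const M
  obtain ⟨N, hN⟩ := eventually_atTop.1 (hlim.eventually_lt_const hε)
  obtain ⟨A, hA⟩ := i.a_tendsto.bddAbove_range
  have hA0 : 0 < A := (i.a_pos 0).trans_le (hA ⟨0, rfl⟩)
  refine ⟨N, ε / A, by positivity, fun φ hφ h => Real.iSup_le (fun n => ?_) hε.le⟩
  rcases lt_or_ge n N with hn | hn
  · calc i.a n * supOn (i.C n) φ ≤ A * (ε / A) :=
          mul_le_mul (hA ⟨n, rfl⟩) (supOn_le (by positivity) (h n hn)) (supOn_nonneg _ _) hA0.le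
      _ = ε := by field_simp
  · exact (mul_le_mul_of_nonneg_left ((supOn_le_norm _ φ).trans hφ) (i.a_pos n).le).trans
      (hN n hn).le

/-- Outside a finite box one factor is small and the other bounded. Enumerated by `ℕ`, these
products are admissible weights for the seminorm that controls the operators. -/
theorem MixedIndex.tendsto_mul_inv_two_pow {X : Type*} [TopologicalSpace X] (i : MixedIndex X) :
    Tendsto (fun p : ℕ × ℕ => i.a p.1 * (2⁻¹ : ℝ) ^ p.2) cofinite (𝓝 0) := by
  obtain ⟨A, hA⟩ := i.a_tendsto.bddAbove_range
  rw [Metric.tendsto_nhds]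
  intro ε hε
  obtain ⟨N, hN⟩ := eventually_atTop.1 (i.a_tendsto.eventually_lt_const hε)
  have hlim : Tendsto (fun k => A * (2⁻¹ : ℝ) ^ k) atTop (𝓝 0) := by
    simpa using (tendsto_pow_atTop_nhds_zero_of_lt_one (r := (2⁻¹ : ℝ)) (by norm_num)
      (by norm_num)).const_mul A
  obtain ⟨M, hM⟩ := eventually_atTop.1 (hlim.eventually_lt_const hε)
  refine ((Set.finite_Iio N).prod (Set.finite_Iio M)).subset fun p hp => ?_
  by_contra hp'
  refine hp ?_
  change dist _ _ < ε
  have hpos := i.a_pos p.1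
  rw [Real.dist_0_eq_abs, abs_of_nonneg (by positivity)]
  rcases lt_or_ge p.1 N with h1 | h1
  · have h2 : M ≤ p.2 := not_lt.1 fun h2 => hp' ⟨h1, h2⟩
    exact (mul_le_mul_of_nonneg_right (hA ⟨p.1, rfl⟩) (by positivity)).trans_lt (hM _ h2)
  · exact (mul_le_of_le_one_right hpos.le (pow_le_one₀ (by norm_num) (by norm_num))).trans_lt
      (hN _ h1)

/-- Semigroups of operators and families of measures that are compatible and, on compact sets,
continuous, in a space whose addition is continuous on compact sets. -/
structure IsMehlerFamily {X : Type*} [TopologicalSpace X] [AddCommGroup X] [MeasurableSpace X]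
    (T : ℝ≥0 → X → X) (μ : ℝ≥0 → Measure X) : Prop where
  isProbabilityMeasure : ∀ t, IsProbabilityMeasure (μ t)
  map_zero : ∀ x, T 0 x = x
  map_add : ∀ s t x, T (s + t) x = T s (T t x)
  map_add_vec : ∀ t x y, T t (x + y) = T t x + T t y
  measure_zero : ∀ φ : X →ᵇ ℝ, ∫ y, φ y ∂μ 0 = φ 0
  continuousOn_add : ∀ C K : Set X, IsCompact C → IsCompact K →
    ContinuousOn (fun p : X × X => p.1 + p.2) (C ×ˢ K)
  continuousOn_orbit : ∀ (t₀ : ℝ≥0) (C : Set X), IsCompact C →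
    ContinuousOn (fun p : ℝ≥0 × X => T p.1 p.2) (Set.Iic t₀ ×ˢ C)
  tight : ∀ (t₀ : ℝ≥0) (ε : ℝ), 0 < ε → ∃ K : Set X, IsCompact K ∧ ∀ t ≤ t₀, (μ t).real Kᶜ ≤ ε
  continuous_integral : ∀ φ : X →ᵇ ℝ, Continuous fun t => ∫ y, φ y ∂μ t
  integral_add : ∀ (s t : ℝ≥0) (φ : X →ᵇ ℝ),
    ∫ w, φ w ∂μ (s + t) = ∫ y, ∫ z, φ (T t y + z) ∂μ t ∂μ s

namespace IsMehlerFamily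

variable {X : Type*} [TopologicalSpace X] [AddCommGroup X] [MeasurableSpace X]
  {T : ℝ≥0 → X → X} {μ : ℝ≥0 → Measure X}

theorem isCompact_orbit (h : IsMehlerFamily T μ) (t₀ : ℝ≥0) {C : Set X} (hC : IsCompact C) :
    IsCompact ((fun p : ℝ≥0 × X => T p.1 p.2) '' (Set.Iic t₀ ×ˢ C)) := by
  refine IsCompact.image_of_continuousOn ?_ (h.continuousOn_orbit t₀ C hC)
  rw [← Set.Icc_bot]
  exact isCompact_Icc.prod hC

theorem continuous_add_left [CompactlyCoherentSpace X] (h : IsMehlerFamily T μ) (x : X) :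
    Continuous fun y => x + y :=
  continuous_of_continuousOn_isCompact fun K hK =>
    (h.continuousOn_add {x} K isCompact_singleton hK).comp
      (Continuous.prodMk_right x).continuousOn fun _ hy => ⟨rfl, hy⟩

/-- The translate of a bounded continuous function. -/
noncomputable def translate [CompactlyCoherentSpace X] (h : IsMehlerFamily T μ) (φ : X →ᵇ ℝ)
    (x : X) : X →ᵇ ℝ :=
  φ.compContinuous ⟨_, h.continuous_add_left x⟩

theorem translate_apply [CompactlyCoherentSpace X] (h : IsMehlerFamily T μ) (φ : X →ᵇ ℝ)
    (x y : X) : h.translate φ x y = φ (x + y) :=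
  rfl

theorem norm_translate_le [CompactlyCoherentSpace X] (h : IsMehlerFamily T μ) (φ : X →ᵇ ℝ)
    (x : X) : ‖h.translate φ x‖ ≤ ‖φ‖ :=
  φ.norm_compContinuous_le _

theorem abs_integral_le (h : IsMehlerFamily T μ) (φ : X →ᵇ ℝ) (t : ℝ≥0) (x : X) :
    |∫ y, φ (x + y) ∂μ t| ≤ ‖φ‖ := by
  have := h.isProbabilityMeasure t
  refine (norm_integral_le_of_norm_le_const (C := ‖φ‖)
    (Eventually.of_forall fun _ => φ.norm_coe_le_norm _)).trans ?_
  simp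

variable [T2Space X] [CompactlyCoherentSpace X] [OpensMeasurableSpace X]

/-- The increment splits in two: moving the point under a fixed measure is controlled by tightness
and uniformity in `y ∈ K`; moving the measure at a fixed point is weak continuity for a translate of
`φ`. -/
theorem continuousOn_integral (h : IsMehlerFamily T μ) (φ : X →ᵇ ℝ) (t₀ : ℝ≥0) {C : Set X}
    (hC : IsCompact C) :
    ContinuousOn (fun p : ℝ≥0 × X => ∫ y, φ (T p.1 p.2 + y) ∂μ p.1) (Set.Iic t₀ ×ˢ C) := by
  rintro ⟨t, x⟩ ⟨ht, hx⟩
  rw [ContinuousWithinAt, Metric.tendsto_nhds]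
  intro ε hε
  -- A difference of two translates has norm at most `2 * ‖φ‖`, so the complement of `K` costs at
  -- most `ε / 4`; the `+ 1` keeps the divisor positive.
  obtain ⟨K, hK, hKμ⟩ := h.tight t₀ (ε / 4 / (2 * ‖φ‖ + 1)) (by positivity)
  set D := (fun p : ℝ≥0 × X => T p.1 p.2) '' (Set.Iic t₀ ×ˢ C) with hD
  have hcont : ContinuousOn (Function.uncurry fun z y => φ (z + y)) (D ×ˢ K) :=
    φ.continuous.comp_continuousOn (h.continuousOn_add D K (h.isCompact_orbit t₀ hC) hK)
  have hmem : T t x ∈ D := ⟨(t, x), ⟨ht, hx⟩, rfl⟩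
  obtain ⟨v, hv, hvK⟩ := hK.mem_uniformity_of_prod hcont hmem
    (Metric.dist_mem_uniformity (show 0 < ε / 4 by positivity))
  have h1 : ∀ᶠ p in 𝓝[Set.Iic t₀ ×ˢ C] (t, x), T p.1 p.2 ∈ v :=
    ((h.continuousOn_orbit t₀ C hC (t, x) ⟨ht, hx⟩).tendsto_nhdsWithin
      fun p hp => Set.mem_image_of_mem _ hp) hv
  have h2 : ∀ᶠ p in 𝓝[Set.Iic t₀ ×ˢ C] (t, x),
      dist (∫ y, φ (T t x + y) ∂μ p.1) (∫ y, φ (T t x + y) ∂μ t) < ε / 4 := by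
    have hc := ((h.continuous_integral (h.translate φ (T t x))).comp continuous_fst).tendsto (t, x)
    exact (Metric.tendsto_nhds.1 (hc.mono_left nhdsWithin_le_nhds)) _ (by positivity)
  filter_upwards [h1, h2, self_mem_nhdsWithin] with p hp1 hp2 hp3
  have := h.isProbabilityMeasure p.1
  have h3 : dist (∫ y, φ (T p.1 p.2 + y) ∂μ p.1) (∫ y, φ (T t x + y) ∂μ p.1) ≤ ε / 2 := by
    rw [Real.dist_eq]
    have := abs_integral_le_of_abs_le_on (μ p.1)
      (h.translate φ (T p.1 p.2) - h.translate φ (T t x)) hK (η := ε / 4) (by positivity)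
      fun y hy => (hvK _ hp1 y hy).le
    refine le_of_eq_of_le (congrArg abs (integral_sub ((h.translate φ (T p.1 p.2)).integrable (μ p.1))
      ((h.translate φ (T t x)).integrable (μ p.1))).symm) (this.trans ?_)
    have hn : ‖h.translate φ (T p.1 p.2) - h.translate φ (T t x)‖ ≤ 2 * ‖φ‖ + 1 := by
      have := norm_sub_le (h.translate φ (T p.1 p.2)) (h.translate φ (T t x))
      linarith [h.norm_translate_le φ (T p.1 p.2), h.norm_translate_le φ (T t x)]
    have := mul_le_mul hn (hKμ p.1 hp3.1) measureReal_nonneg (by positivity)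
    rw [mul_div_cancel₀ _ (by positivity)] at this
    linarith
  linarith [dist_triangle (∫ y, φ (T p.1 p.2 + y) ∂μ p.1) (∫ y, φ (T t x + y) ∂μ p.1)
    (∫ y, φ (T t x + y) ∂μ t)]

/-- The Mehler operators. -/
noncomputable def operator (h : IsMehlerFamily T μ) (t : ℝ≥0) : (X →ᵇ ℝ) →ₗ[ℝ] (X →ᵇ ℝ) where
  toFun φ := BoundedContinuousFunction.ofNormedAddCommGroup (fun x => ∫ y, φ (T t x + y) ∂μ t)
    (continuous_of_continuousOn_isCompact fun _ hK => (h.continuousOn_integral φ t hK).comp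
      (Continuous.prodMk_right t).continuousOn fun _ hx => ⟨Set.mem_Iic.2 le_rfl, hx⟩)
    ‖φ‖ fun x => h.abs_integral_le φ t _
  map_add' φ ψ := by
    have := h.isProbabilityMeasure t
    ext x
    exact MeasureTheory.integral_add ((h.translate φ (T t x)).integrable (μ t))
      ((h.translate ψ (T t x)).integrable (μ t))
  map_smul' c φ := by
    ext x
    exact integral_const_mul c _

theorem operator_apply (h : IsMehlerFamily T μ) (t : ℝ≥0) (φ : X →ᵇ ℝ) (x : X) :
    h.operator t φ x = ∫ y, φ (T t x + y) ∂μ t :=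
  rfl

theorem norm_operator_le (h : IsMehlerFamily T μ) (t : ℝ≥0) (φ : X →ᵇ ℝ) :
    ‖h.operator t φ‖ ≤ ‖φ‖ :=
  BoundedContinuousFunction.norm_ofNormedAddCommGroup_le _ (norm_nonneg φ)
    fun _ => h.abs_integral_le φ t _

theorem operator_zero (h : IsMehlerFamily T μ) (φ : X →ᵇ ℝ) : h.operator 0 φ = φ := by
  ext x
  rw [operator_apply, h.map_zero]
  simpa [translate_apply] using h.measure_zero (h.translate φ x)

theorem operator_add (h : IsMehlerFamily T μ) (s t : ℝ≥0) (φ : X →ᵇ ℝ) :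
    h.operator s (h.operator t φ) = h.operator (s + t) φ := by
  ext x
  simp only [operator_apply]
  have := h.integral_add s t (h.translate φ (T (s + t) x))
  simp only [translate_apply] at this
  rw [this]
  simp only [add_comm s t, h.map_add t s, h.map_add_vec, add_assoc]


/-! ### Local equicontinuity of the Mehler operators. -/

omit [T2Space X] [CompactlyCoherentSpace X] [OpensMeasurableSpace X] in
theorem exists_measure_compl_le (h : IsMehlerFamily T μ) (t₀ : ℝ≥0) :
    ∃ K : ℕ → Set X, (∀ k, IsCompact (K k)) ∧
      ∀ t ≤ t₀, ∀ k, μ t (K k)ᶜ ≤ (4⁻¹ : ENNReal) ^ (k + 1) := by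
  choose K hK hKμ using fun k : ℕ => h.tight t₀ ((4⁻¹ : ℝ) ^ (k + 1)) (by positivity)
  refine ⟨K, hK, fun t ht k => ?_⟩
  have := h.isProbabilityMeasure t
  rw [← ofReal_measureReal]
  refine (ENNReal.ofReal_le_ofReal (hKμ k t ht)).trans ?_
  rw [ENNReal.ofReal_pow (by positivity), ENNReal.ofReal_inv_of_pos (by norm_num)]
  simp

omit [TopologicalSpace X] [AddCommGroup X] [T2Space X] [CompactlyCoherentSpace X]
  [OpensMeasurableSpace X] in
theorem ae_exists_mem_of_measure_compl_le {μ : Measure X} {K : ℕ → Set X}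
    (hμ : ∀ k, μ (K k)ᶜ ≤ (4⁻¹ : ENNReal) ^ (k + 1)) : ∀ᵐ y ∂μ, ∃ k, y ∈ K k := by
  rw [ae_iff]
  have hlim : Tendsto (fun k => (4⁻¹ : ENNReal) ^ (k + 1)) atTop (𝓝 0) :=
    (ENNReal.tendsto_pow_atTop_nhds_zero_of_lt_one (by norm_num)).comp (tendsto_add_atTop_nat 1)
  exact le_antisymm (ge_of_tendsto' hlim fun k =>
    (measure_mono fun y (hy : ¬∃ k, y ∈ K k) hk => hy ⟨k, hk⟩).trans (hμ k)) zero_le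

-- The integrand dominates `2 ^ m`, with `m` the first index such that `y ∈ K m`. The `k`-th term
-- integrates to at most `2 ^ (k + 1) * 4⁻¹ ^ (k + 1)`, and these bounds sum to `1`.
omit [TopologicalSpace X] [AddCommGroup X] [T2Space X] [CompactlyCoherentSpace X]
  [OpensMeasurableSpace X] in
theorem lintegral_dyadic_le {μ : Measure X} [IsProbabilityMeasure μ] {K : ℕ → Set X}
    (hK : ∀ k, MeasurableSet (K k)) (hμ : ∀ k, μ (K k)ᶜ ≤ (4⁻¹ : ENNReal) ^ (k + 1)) :
    ∫⁻ y, (1 + ∑' k, (K k)ᶜ.indicator (fun _ => (2 : ENNReal) ^ (k + 1)) y) ∂μ ≤ 2 := by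
  have hm : ∀ k, Measurable ((K k)ᶜ.indicator (fun _ => (2 : ENNReal) ^ (k + 1))) := fun k =>
    measurable_const.indicator (hK k).compl
  rw [lintegral_add_left measurable_const, lintegral_tsum fun k => (hm k).aemeasurable]
  simp only [lintegral_const, measure_univ, mul_one]
  calc (1 : ENNReal) + ∑' k, ∫⁻ y, (K k)ᶜ.indicator (fun _ => (2 : ENNReal) ^ (k + 1)) y ∂μ
      ≤ 1 + ∑' k : ℕ, (2⁻¹ : ENNReal) ^ (k + 1) := by
        gcongr with k
        rw [lintegral_indicator_const (hK k).compl]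
        refine (mul_le_mul_right (hμ k) _).trans_eq ?_
        rw [← mul_pow]
        congr 1
        rw [show (4 : ENNReal) = 2 * 2 by norm_num, ENNReal.mul_inv (by simp) (by simp),
          ← mul_assoc, ENNReal.mul_inv_cancel (by simp) (by simp), one_mul]
    _ = 2 := by rw [ENNReal.tsum_geometric_add_one, ENNReal.one_sub_inv_two, inv_inv,
          ENNReal.inv_mul_cancel (by simp) (by simp), one_add_one_eq_two]

theorem exists_mixedSup_operator_le (h : IsMehlerFamily T μ) (t₀ : ℝ≥0) (i : MixedIndex X) :
    ∃ j : MixedIndex X, ∀ t ≤ t₀, ∀ φ, mixedSup i (h.operator t φ) ≤ 2 * mixedSup j φ := by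
  obtain ⟨K, hK, hKμ⟩ := h.exists_measure_compl_le t₀
  have hKm : ∀ k, MeasurableSet (K k) := fun k => (hK k).isClosed.measurableSet
  set D : ℕ → Set X := fun n => (fun p : ℝ≥0 × X => T p.1 p.2) '' (Set.Iic t₀ ×ˢ i.C n)
  have hD : ∀ n, IsCompact (D n) := fun n => h.isCompact_orbit t₀ (i.isCompact_C n)
  have hlim : Tendsto (fun m : ℕ => i.a m.unpair.1 * (2⁻¹ : ℝ) ^ m.unpair.2) atTop (𝓝 0) := by
    rw [← Nat.cofinite_eq_atTop]
    exact i.tendsto_mul_inv_two_pow.comp Nat.pairEquiv.symm.injective.tendsto_cofinite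
  -- The new seminorm has weight `a n * 2⁻ᵏ` on `D n + K k`, the pairs `(n, k)` being coded by
  -- `Nat.unpair`.
  refine ⟨{ C := fun m => (fun p : X × X => p.1 + p.2) '' (D m.unpair.1 ×ˢ K m.unpair.2)
            a := fun m => i.a m.unpair.1 * (2⁻¹ : ℝ) ^ m.unpair.2
            isCompact_C := fun m => ((hD _).prod (hK _)).image_of_continuousOn
              (h.continuousOn_add _ _ (hD _) (hK _))
            a_pos := fun m => mul_pos (i.a_pos _) (by positivity)
            a_tendsto := hlim }, fun t ht φ => ?_⟩
  set j : MixedIndex X := _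
  have := h.isProbabilityMeasure t
  change mixedSup i (h.operator t φ) ≤ 2 * mixedSup j φ
  set q := mixedSup j φ
  have hq : 0 ≤ q := mixedSup_nonneg j φ
  have hle : ∀ n k, ∀ z ∈ D n, ∀ y ∈ K k, i.a n * |φ (z + y)| ≤ q * 2 ^ k := by
    intro n k z hz y hy
    have h1 := le_mixedSup j φ (Nat.pair n k)
    have h2 : |φ (z + y)| ≤ supOn (j.C (Nat.pair n k)) φ :=
      abs_le_supOn φ ⟨(z, y), by simp [hz, hy], rfl⟩
    have h3 : j.a (Nat.pair n k) = i.a n * (2⁻¹ : ℝ) ^ k := by simp [j]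
    have h4 := (mul_le_mul_of_nonneg_left h2 (j.a_pos (Nat.pair n k)).le).trans h1
    rw [h3] at h4
    calc i.a n * |φ (z + y)| = i.a n * (2⁻¹ : ℝ) ^ k * |φ (z + y)| * 2 ^ k := by
          rw [inv_pow]; field_simp
      _ ≤ q * 2 ^ k := by gcongr
  have hpt : ∀ n, ∀ z ∈ D n, ∀ᵐ y ∂μ t, ENNReal.ofReal (i.a n * |φ (z + y)|) ≤
      ENNReal.ofReal q * (1 + ∑' k, (K k)ᶜ.indicator (fun _ => (2 : ENNReal) ^ (k + 1)) y) := by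
    intro n z hz
    have hae : ∀ᵐ y ∂μ t, ∃ k, y ∈ K k := ae_exists_mem_of_measure_compl_le (hKμ t ht)
    filter_upwards [hae] with y hy
    classical
    have hm := Nat.find_spec hy
    have hm' := fun k => Nat.find_min hy (m := k)
    set m := Nat.find hy
    refine (ENNReal.ofReal_le_ofReal (hle n m z hz y hm)).trans ?_
    rw [ENNReal.ofReal_mul hq, ENNReal.ofReal_pow (by norm_num), ENNReal.ofReal_ofNat]
    gcongr
    -- If the first index is `0`, the summand `1` suffices; otherwise `y` misses the preceding
    -- compact set, whose term is exactly the required power of `2`.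
    rcases m with _ | m
    · simp
    · refine le_trans ?_ le_add_self
      refine le_trans ?_ (ENNReal.le_tsum m)
      rw [Set.indicator_of_mem (hm' m (Nat.lt_succ_self m))]
  refine Real.iSup_le (fun n => ?_) (by positivity)
  rw [← le_div_iff₀' (i.a_pos n)]
  refine supOn_le (by have := i.a_pos n; positivity) fun x hx => ?_
  rw [le_div_iff₀' (i.a_pos n), operator_apply]
  have hz : T t x ∈ D n := ⟨(t, x), ⟨ht, hx⟩, rfl⟩
  have hlin : ENNReal.ofReal (i.a n * |∫ y, φ (T t x + y) ∂μ t|) ≤ ENNReal.ofReal (2 * q) := by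
    calc ENNReal.ofReal (i.a n * |∫ y, φ (T t x + y) ∂μ t|)
        = ‖∫ y, i.a n * φ (T t x + y) ∂μ t‖ₑ := by
          rw [integral_const_mul, ← ofReal_norm, norm_mul, Real.norm_eq_abs,
            abs_of_pos (i.a_pos n), Real.norm_eq_abs]
      _ ≤ ∫⁻ y, ‖i.a n * φ (T t x + y)‖ₑ ∂μ t := enorm_integral_le_lintegral_enorm _
      _ ≤ ∫⁻ y, ENNReal.ofReal q *
            (1 + ∑' k, (K k)ᶜ.indicator (fun _ => (2 : ENNReal) ^ (k + 1)) y) ∂μ t := by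
          refine lintegral_mono_ae ?_
          filter_upwards [hpt n _ hz] with y hy
          rwa [← ofReal_norm, norm_mul, Real.norm_eq_abs,
            abs_of_pos (i.a_pos n), Real.norm_eq_abs]
      _ ≤ ENNReal.ofReal q * 2 := by
          rw [lintegral_const_mul' _ _ ENNReal.ofReal_ne_top]
          gcongr
          exact lintegral_dyadic_le hKm (hKμ t ht)
      _ = ENNReal.ofReal (2 * q) := by
          rw [mul_comm 2 q, ENNReal.ofReal_mul hq, ENNReal.ofReal_ofNat]
  exact (ENNReal.ofReal_le_ofReal_iff (by positivity)).1 hlin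

/-! ### Strong continuity at zero. -/

theorem eventually_abs_operator_sub_le (h : IsMehlerFamily T μ) (φ : X →ᵇ ℝ) {C : Set X}
    (hC : IsCompact C) {δ : ℝ} (hδ : 0 < δ) :
    ∀ᶠ t in 𝓝 0, ∀ x ∈ C, |(h.operator t φ - φ) x| ≤ δ := by
  obtain ⟨v, hv, hvC⟩ := hC.mem_uniformity_of_prod (s := Set.Iic 1) (q := 0)
    (f := fun t x => h.operator t φ x) (h.continuousOn_integral φ 1 hC) (by simp)
    (Metric.dist_mem_uniformity hδ)
  rw [nhdsWithin_eq_nhds.2 (Iic_mem_nhds one_pos)] at hv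
  filter_upwards [hv] with t ht x hx
  have := hvC t ht x hx
  simp only [h.operator_zero] at this
  exact (Set.mem_ofPred_eq ▸ this : dist _ _ < δ).le

theorem tendsto_operator (h : IsMehlerFamily T μ) (φ : X →ᵇ ℝ) :
    Tendsto (fun t => h.operator t φ) (𝓝 0) (@nhds _ (mixedTopology X) φ) := by
  let _ : TopologicalSpace (X →ᵇ ℝ) := mixedTopology X
  refine ((WithSeminorms.mk rfl : WithSeminorms (mixedSeminorm X)).tendsto_nhds _ _).2
    fun i ε hε => ?_
  -- Since `‖P_t φ - φ‖ ≤ 2 * ‖φ‖`, only finitely many of the compact sets matter.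
  obtain ⟨N, δ, hδ, hN⟩ := mixedSup_le_of_bound i (M := 2 * ‖φ‖) (half_pos hε)
  have := (Finset.range N).eventually_all.2 fun n _ =>
    h.eventually_abs_operator_sub_le φ (i.isCompact_C n) hδ
  filter_upwards [this] with t ht
  refine (hN _ ?_ fun n hn => ht n (Finset.mem_range.2 hn)).trans_lt (half_lt_self hε)
  linarith [norm_sub_le (h.operator t φ) φ, h.norm_operator_le t φ]

/-- The Mehler operators form a `C_0`-semigroup for the mixed topology. -/
theorem isMixedC0Semigroup (h : IsMehlerFamily T μ) :
    IsMixedC0Semigroup fun t => ⇑(h.operator t) where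
  map_zero := h.operator_zero
  map_add := h.operator_add
  equicontinuous t₀ ε hε i := by
    obtain ⟨j, hj⟩ := h.exists_mixedSup_operator_le t₀ i
    refine ⟨j, ε / 2, half_pos hε, fun t ht φ₁ φ₂ hφ => ?_⟩
    rw [← map_sub]
    have := hj t ht (φ₁ - φ₂)
    change mixedSup i _ < ε
    change mixedSup j _ < ε / 2 at hφ
    linarith
  tendsto_zero := h.tendsto_operator

end IsMehlerFamily

/-! ### `C_0`-semigroups of bounded linear operators -/

namespace IsC0Semigroup

variable {E : Type*} [NormedAddCommGroup E] [NormedSpace ℝ E] {T : ℝ≥0 → E →L[ℝ] E}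

/-- Were the norms unbounded along some `u n → 0`, the convergent, hence bounded, orbits `T (u n) x`
would contradict Banach–Steinhaus. -/
theorem exists_norm_le_near_zero [CompleteSpace E] (hT : IsC0Semigroup T) :
    ∃ δ > 0, ∃ M, ∀ t ≤ δ, ‖T t‖ ≤ M := by
  by_contra! hcon
  choose u hu huM using fun n : ℕ => hcon (1 / ((n : ℝ≥0) + 1)) (by positivity) n
  have hu0 : Tendsto u atTop (𝓝 0) :=
    tendsto_of_tendsto_of_tendsto_of_le_of_le tendsto_const_nhds
      tendsto_one_div_add_atTop_nhds_zero_nat (fun _ => zero_le) hu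
  obtain ⟨C, hC⟩ := banach_steinhaus (g := fun n => T (u n)) fun x => by
    obtain ⟨C, hC⟩ := ((hT.tendsto_zero x).comp hu0).norm.bddAbove_range
    exact ⟨C, fun n => hC ⟨n, rfl⟩⟩
  obtain ⟨n, hn⟩ := exists_nat_gt C
  linarith [huM n, hC n]

theorem exists_norm_le [CompleteSpace E] (hT : IsC0Semigroup T) (t₀ : ℝ≥0) :
    ∃ M, 1 ≤ M ∧ ∀ t ≤ t₀, ‖T t‖ ≤ M := by
  obtain ⟨δ, hδ, M, hM⟩ := hT.exists_norm_le_near_zero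
  -- Each step of length `δ` costs one factor; `max M 1` makes the powers increasing.
  have key : ∀ n : ℕ, ∀ t ≤ n * δ, ‖T t‖ ≤ (max M 1) ^ (n + 1) := by
    intro n
    induction n with
    | zero => intro t ht; simpa using Or.inl (hM t ((by simpa using ht : t = 0) ▸ zero_le))
    | succ n ih =>
      intro t ht
      rcases le_total t δ with h | h
      · exact (hM t h).trans ((le_max_left _ _).trans
          (le_self_pow₀ (le_max_right _ _) (Nat.succ_ne_zero _)))
      · have hsub : t - δ ≤ n * δ := by
          rw [tsub_le_iff_right]
          calc t ≤ _ := ht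
            _ = _ := by push_cast; ring
        rw [← tsub_add_cancel_of_le h, hT.map_add]
        calc ‖(T (t - δ)).comp (T δ)‖ ≤ ‖T (t - δ)‖ * ‖T δ‖ := ContinuousLinearMap.opNorm_comp_le _ _
          _ ≤ (max M 1) ^ (n + 1) * max M 1 :=
            mul_le_mul (ih _ hsub) ((hM δ le_rfl).trans (le_max_left _ _)) (norm_nonneg _)
              (by positivity)
          _ = _ := (pow_succ _ _).symm
  obtain ⟨n, hn⟩ := exists_nat_ge (t₀ / δ)
  refine ⟨(max M 1) ^ (n + 1), one_le_pow₀ (le_max_right _ _), fun t ht => key n t (ht.trans ?_)⟩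
  rwa [div_le_iff₀ hδ] at hn

/-- Factoring out the smaller time reduces continuity from both sides to continuity at `0`; `max s t
- min s t` is `|s - t|` within `ℝ≥0`. -/
theorem norm_sub_le [CompleteSpace E] (hT : IsC0Semigroup T) {t₀ : ℝ≥0} {M : ℝ}
    (hM : ∀ t ≤ t₀, ‖T t‖ ≤ M) {s t : ℝ≥0} (hs : s ≤ t₀) (ht : t ≤ t₀) (x : E) :
    ‖T s x - T t x‖ ≤ M * ‖T (max s t - min s t) x - x‖ := by
  wlog hst : s ≤ t generalizing s t
  · rw [norm_sub_rev, max_comm, min_comm]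
    exact this ht hs (le_of_not_ge hst)
  rw [max_eq_right hst, min_eq_left hst, norm_sub_rev]
  have : T t x - T s x = T s (T (t - s) x - x) := by
    rw [map_sub, ← ContinuousLinearMap.comp_apply, ← hT.map_add, add_tsub_cancel_of_le hst]
  rw [this]
  exact (T s).le_of_opNorm_le (hM s hs) _

theorem continuous_apply [CompleteSpace E] (hT : IsC0Semigroup T) (x : E) :
    Continuous fun t => T t x := by
  rw [continuous_iff_continuousAt]
  intro t
  obtain ⟨M, -, hM⟩ := hT.exists_norm_le (t + 1)
  have hdiff : Tendsto (fun s => max s t - min s t) (𝓝 t) (𝓝 0) := by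
    have : Continuous fun s : ℝ≥0 => max s t - min s t := by fun_prop
    simpa using this.tendsto t
  have hlim : Tendsto (fun s => M * ‖T (max s t - min s t) x - x‖) (𝓝 t) (𝓝 0) := by
    simpa using ((((hT.tendsto_zero x).comp hdiff).sub_const x).norm).const_mul M
  rw [ContinuousAt, tendsto_iff_norm_sub_tendsto_zero]
  refine squeeze_zero' (Eventually.of_forall fun _ => norm_nonneg _) ?_ hlim
  filter_upwards [Iic_mem_nhds (lt_add_one t)] with s hs
  exact hT.norm_sub_le hM hs (le_add_of_nonneg_right zero_le) x

theorem continuous_uncurry [CompleteSpace E] (hT : IsC0Semigroup T) :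
    Continuous fun p : ℝ≥0 × E => T p.1 p.2 := by
  rw [continuous_iff_continuousAt]
  rintro ⟨t, x⟩
  obtain ⟨M, -, hM⟩ := hT.exists_norm_le (t + 1)
  have h1 : Tendsto (fun p : ℝ≥0 × E => M * ‖p.2 - x‖ + ‖T p.1 x - T t x‖) (𝓝 (t, x)) (𝓝 0) := by
    have : Continuous fun p : ℝ≥0 × E => M * ‖p.2 - x‖ + ‖T p.1 x - T t x‖ := by
      have hc : Continuous fun p : ℝ≥0 × E => T p.1 x := (hT.continuous_apply x).comp continuous_fst
      exact (continuous_const.mul (continuous_snd.sub continuous_const).norm).add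
        (hc.sub continuous_const).norm
    simpa using this.tendsto (t, x)
  rw [ContinuousAt, tendsto_iff_norm_sub_tendsto_zero]
  refine squeeze_zero' (Eventually.of_forall fun _ => norm_nonneg _) ?_ h1
  filter_upwards [continuous_fst.continuousAt.preimage_mem_nhds (Iic_mem_nhds (lt_add_one t))]
    with p hp
  calc ‖T p.1 p.2 - T t x‖ = ‖T p.1 (p.2 - x) + (T p.1 x - T t x)‖ := by rw [map_sub]; abel_nf
    _ ≤ _ := (norm_add_le _ _).trans
      (add_le_add ((T p.1).le_of_opNorm_le (hM _ hp) _) le_rfl)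

end IsC0Semigroup

/-! ### Convolution identities -/

section Convolution

variable {E : Type*} [NormedAddCommGroup E] [NormedSpace ℝ E] [CompleteSpace E]
  [TopologicalSpace.SeparableSpace E] [MeasurableSpace E] [BorelSpace E]

/-- An idempotent probability measure on a Banach space is the Dirac measure at the origin. -/
theorem eq_dirac_of_conv_self (μ : Measure E) [IsProbabilityMeasure μ] (h : μ = μ ∗ μ) :
    μ = Measure.dirac 0 := by
  have := UniformSpace.secondCountable_of_separable E
  refine Measure.ext_of_charFunDual (funext fun L => ?_)
  have hsq : ∀ L, charFunDual μ L = charFunDual μ L * charFunDual μ L := fun L => by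
    conv_lhs => rw [h]
    exact charFunDual_conv L
  have h01 : ∀ L, charFunDual μ L = 0 ∨ charFunDual μ L = 1 := fun L => by
    have := hsq L
    by_cases h0 : charFunDual μ L = 0
    · exact Or.inl h0
    · exact Or.inr (mul_left_cancel₀ h0 (by rw [mul_one, ← this]))
  have hcont : Continuous fun r : ℝ => charFunDual μ (r • L) := by
    simp only [charFunDual_apply]
    refine continuous_of_dominated (bound := fun _ => 1) (fun r => ?_) (fun r => ?_)
      (integrable_const 1) (Eventually.of_forall fun x => ?_)
    · exact (by fun_prop : Continuous _).aestronglyMeasurable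
    · exact Eventually.of_forall fun x => (Complex.norm_exp_ofReal_mul_I _).le
    · simp only [_root_.smul_apply, smul_eq_mul]
      fun_prop
  -- Along the line through `L` the characteristic function is continuous with values in `{0, 1}`
  -- and equals `1` at `0`, so connectedness forces it to be `1`.
  have hclopen : IsClopen {r : ℝ | charFunDual μ (r • L) = 1} := by
    refine ⟨isClosed_eq hcont continuous_const, ?_⟩
    have : {r : ℝ | charFunDual μ (r • L) = 1} = {r : ℝ | charFunDual μ (r • L) ≠ 0} := by
      ext r
      rcases h01 (r • L) with h | h <;> simp [h]
    rw [this]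
    exact isOpen_ne_fun hcont continuous_const
  have hone : (1 : ℝ) ∈ {r : ℝ | charFunDual μ (r • L) = 1} := by
    rw [hclopen.eq_univ ⟨0, by simp [charFunDual_apply]⟩]
    trivial
  simpa [charFunDual_dirac] using hone

theorem measure_zero_eq_dirac {T : ℝ≥0 → E →L[ℝ] E} (hT : IsC0Semigroup T)
    {μ : ℝ≥0 → Measure E} (hμ : ∀ t, IsProbabilityMeasure (μ t))
    (hconv : ∀ t s, μ (t + s) = ((μ t).map (T s)) ∗ μ s) : μ 0 = Measure.dirac 0 := by
  refine eq_dirac_of_conv_self (μ 0) ?_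
  have := hconv 0 0
  rw [hT.map_zero, add_zero] at this
  rwa [show ⇑(ContinuousLinearMap.id ℝ E) = id from rfl, Measure.map_id] at this

omit [CompleteSpace E] in
theorem integral_map_conv {μ ν : Measure E} [IsProbabilityMeasure μ] [IsProbabilityMeasure ν]
    (A : E →L[ℝ] E) (φ : E →ᵇ ℝ) :
    ∫ w, φ w ∂(μ.map A ∗ ν) = ∫ y, ∫ z, φ (A y + z) ∂ν ∂μ := by
  have := UniformSpace.secondCountable_of_separable E
  have := Measure.isProbabilityMeasure_map (μ := μ) A.continuous.aemeasurable
  rw [integral_conv (φ.integrable _), integral_map A.continuous.aemeasurable]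
  refine Continuous.aestronglyMeasurable ?_
  refine continuous_of_dominated (bound := fun _ => ‖φ‖) (fun x => ?_) (fun x => ?_)
    (integrable_const _) (Eventually.of_forall fun y => ?_)
  · exact (φ.continuous.comp (continuous_const_add x)).aestronglyMeasurable
  · exact Eventually.of_forall fun y => φ.norm_coe_le_norm _
  · exact φ.continuous.comp (continuous_add_const y)

end Convolution

/-! ### Mehler semigroups for the norm topology -/

section Norm

variable {E : Type*} [NormedAddCommGroup E] [NormedSpace ℝ E] [CompleteSpace E]
  [TopologicalSpace.SeparableSpace E] [MeasurableSpace E] [BorelSpace E]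

omit [NormedSpace ℝ E] in
-- The image of `[0, t₀]` in the space of probability measures is compact, hence tight, `E` being
-- Polish.
theorem exists_isCompact_measureReal_compl_le {μ : ℝ≥0 → Measure E}
    (hμ : ∀ t, IsProbabilityMeasure (μ t))
    (hcont : ∀ φ : E →ᵇ ℝ, Continuous fun t => ∫ y, φ y ∂μ t) (t₀ : ℝ≥0) {ε : ℝ} (hε : 0 < ε) :
    ∃ K : Set E, IsCompact K ∧ ∀ t ≤ t₀, (μ t).real Kᶜ ≤ ε := by
  have := UniformSpace.secondCountable_of_separable E
  let ν : ℝ≥0 → ProbabilityMeasure E := fun t => ⟨μ t, hμ t⟩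
  have hν : Continuous ν :=
    ProbabilityMeasure.continuous_iff_forall_continuous_integral.2 hcont
  have hc : IsCompact (ν '' Set.Icc 0 t₀) := isCompact_Icc.image hν
  have ht := isTightMeasureSet_of_isCompact_closure hc.closure
  obtain ⟨K, hK, hKμ⟩ := isTightMeasureSet_iff_exists_isCompact_measure_compl_le.1 ht
    (ENNReal.ofReal ε) (by simpa using hε)
  exact ⟨K, hK, fun t ht => ENNReal.toReal_le_of_le_ofReal hε.le
    (hKμ (μ t) ⟨ν t, ⟨t, ⟨zero_le, ht⟩, rfl⟩, rfl⟩)⟩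

theorem isMehlerFamily_norm {T : ℝ≥0 → E →L[ℝ] E} (hT : IsC0Semigroup T)
    {μ : ℝ≥0 → Measure E} (hμ : ∀ t, IsProbabilityMeasure (μ t))
    (hconv : ∀ t s, μ (t + s) = ((μ t).map (T s)) ∗ μ s)
    (hcont : ∀ φ : E →ᵇ ℝ, Continuous fun t => ∫ y, φ y ∂μ t) :
    IsMehlerFamily (fun t => ⇑(T t)) μ where
  isProbabilityMeasure := hμ
  map_zero x := by rw [hT.map_zero]; rfl
  map_add s t x := by rw [hT.map_add]; rfl
  map_add_vec t x y := _root_.map_add (T t) x y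
  measure_zero φ := by
    rw [measure_zero_eq_dirac hT hμ hconv, integral_dirac]
  continuousOn_add _ _ _ _ := continuous_add.continuousOn
  continuousOn_orbit _ _ _ := hT.continuous_uncurry.continuousOn
  tight t₀ _ hε := exists_isCompact_measureReal_compl_le hμ hcont t₀ hε
  continuous_integral := hcont
  integral_add s t φ := by
    rw [hconv s t]
    exact integral_map_conv (T t) φ

end Norm

/-! ### Topology of the bounded weak space -/

section WeakSpace

variable {E : Type*} [NormedAddCommGroup E] [NormedSpace ℝ E]

theorem isEmbedding_weakSpace : IsEmbedding fun (x : WeakSpace ℝ E) (f : StrongDual ℝ E) =>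
    f ((toWeakSpace ℝ E).symm x) :=
  WeakBilin.isEmbedding (B := (topDualPairing ℝ E).flip) fun _ _ hxy =>
    (SeparatingDual.eq_iff_forall_dual_eq (R := ℝ)).2 fun f => LinearMap.congr_fun hxy f

theorem continuous_weakSpace_apply (f : StrongDual ℝ E) :
    Continuous fun x : WeakSpace ℝ E => f ((toWeakSpace ℝ E).symm x) :=
  (continuous_apply f).comp isEmbedding_weakSpace.continuous

theorem continuousOn_weakSpace_iff {Y : Type*} [TopologicalSpace Y] {g : Y → WeakSpace ℝ E}
    {S : Set Y} : ContinuousOn g S ↔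
      ∀ f : StrongDual ℝ E, ContinuousOn (fun y => f ((toWeakSpace ℝ E).symm (g y))) S := by
  rw [isEmbedding_weakSpace.isInducing.continuousOn_iff, continuousOn_pi]
  rfl

/-- Each functional is bounded on `K`; Banach–Steinhaus applies to `K` viewed in the bidual. -/
theorem IsCompact.exists_norm_le_of_weakSpace {K : Set (WeakSpace ℝ E)} (hK : IsCompact K) :
    ∃ R : ℝ, ∀ x ∈ K, ‖(toWeakSpace ℝ E).symm x‖ ≤ R := by
  obtain ⟨R, hR⟩ := banach_steinhaus
    (g := fun x : K => NormedSpace.inclusionInDoubleDual ℝ E ((toWeakSpace ℝ E).symm x)) fun f => by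
      obtain ⟨C, hC⟩ := hK.exists_bound_of_continuousOn (continuous_weakSpace_apply f).continuousOn
      exact ⟨C, fun x => hC x x.2⟩
  refine ⟨R, fun x hx => ?_⟩
  rw [← (NormedSpace.inclusionInDoubleDualLi ℝ).norm_map]
  exact hR ⟨x, hx⟩

/-- This is Banach–Alaoglu in the bidual, all of whose points come from `E`. -/
theorem IsReflexiveSpace.exists_isCompact_weakSpace (hE : IsReflexiveSpace E) (R : ℝ) :
    ∃ K : Set (WeakSpace ℝ E), IsCompact K ∧ ∀ x : E, ‖x‖ ≤ R → toWeakSpace ℝ E x ∈ K := by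
  refine ⟨_, NormedSpace.isCompact_closure_of_isBounded ℝ E
    ((toWeakSpace ℝ E).symm ⁻¹' Metric.closedBall 0 R) ?_ ?_, fun x hx => subset_closure ?_⟩
  · exact Metric.isBounded_closedBall
  · intro y _
    obtain ⟨x, hx⟩ := hE (WeakDual.toStrongDual y)
    exact ⟨toWeakSpace ℝ E x, hx⟩
  · simpa using hx

end WeakSpace

namespace BWSpace

variable {E : Type*} [NormedAddCommGroup E] [NormedSpace ℝ E]

instance : AddCommGroup (BWSpace E) := ‹NormedAddCommGroup E›.toAddCommGroup

instance [m : MeasurableSpace E] : MeasurableSpace (BWSpace E) := m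

/-- The identity map from the bounded weak topology to the weak topology. -/
noncomputable def toWeak : BWSpace E ≃ WeakSpace ℝ E := toBW.symm.trans (toWeakSpace ℝ E).toEquiv

theorem isClosed_iff {A : Set (BWSpace E)} :
    IsClosed A ↔ ∀ K : Set (WeakSpace ℝ E), IsCompact K → IsClosed (toWeak '' A ∩ K) := by
  have h : IsClosed A ↔ ∀ K : Set E, IsCompact (toWeakSpace ℝ E '' K) →
      IsClosed (toWeakSpace ℝ E '' (toBW ⁻¹' A ∩ K)) := by
    rw [← isOpen_compl_iff]
    change Aᶜᶜ ∈ _ ↔ _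
    rw [compl_compl]
    rfl
  have himg : ∀ K : Set E, toWeakSpace ℝ E '' (toBW ⁻¹' A ∩ K) =
      toWeak '' A ∩ toWeakSpace ℝ E '' K := fun K => by
    rw [Set.image_inter (toWeakSpace ℝ E).injective]
    rfl
  simp only [h, himg]
  exact ⟨fun hA K hK => by
    have := hA (toWeakSpace ℝ E ⁻¹' K)
    rw [Set.image_preimage_eq _ (toWeakSpace ℝ E).surjective] at this
    exact this hK, fun hA K hK => hA _ hK⟩

theorem continuous_toWeak : Continuous (toWeak : BWSpace E → WeakSpace ℝ E) := by
  refine continuous_iff_isClosed.2 fun A hA => isClosed_iff.2 fun K hK => ?_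
  rw [Set.image_preimage_eq _ toWeak.surjective]
  exact hA.inter hK.isClosed

theorem continuousOn_toWeak_symm {K : Set (WeakSpace ℝ E)} (hK : IsCompact K) :
    ContinuousOn (toWeak.symm : WeakSpace ℝ E → BWSpace E) K := by
  refine continuousOn_iff_isClosed.2 fun A hA => ⟨toWeak '' A ∩ K, isClosed_iff.1 hA K hK, ?_⟩
  rw [← Equiv.image_eq_preimage_symm, Set.inter_assoc, Set.inter_self]

theorem isCompact_image_symm {K : Set (WeakSpace ℝ E)} (hK : IsCompact K) :
    IsCompact (toWeak.symm '' K) :=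
  hK.image_of_continuousOn (continuousOn_toWeak_symm hK)

/-- The image of `S` is weakly compact, and the weak and bounded weak topologies agree on weakly
compact sets. Continuity on compact sets can thus be tested weakly. -/
theorem continuousOn_of_isCompact {Y : Type*} [TopologicalSpace Y] {S : Set Y} (hS : IsCompact S)
    {f : Y → BWSpace E} (hf : ContinuousOn (fun y => toWeak (f y)) S) : ContinuousOn f S := by
  have := (continuousOn_toWeak_symm (hS.image_of_continuousOn hf)).comp hf
    fun y hy => Set.mem_image_of_mem _ hy
  simpa [Function.comp_def] using this

instance : T2Space (BWSpace E) :=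
  T2Space.of_injective_continuous toWeak.injective continuous_toWeak

instance : CompactlyCoherentSpace (BWSpace E) := by
  refine CompactlyCoherentSpace.of_isClosed fun A hA => isClosed_iff.2 fun K hK => ?_
  have hK' := isCompact_image_symm hK
  have h1 := (hK'.isClosed.isClosedEmbedding_subtypeVal.isClosed_iff_image_isClosed).1 (hA _ hK')
  rw [Subtype.image_preimage_coe] at h1
  have h2 := ((hK'.of_isClosed_subset h1 Set.inter_subset_left).image continuous_toWeak).isClosed
  rwa [Set.image_inter toWeak.injective, ← Set.image_comp, Equiv.self_comp_symm, Set.image_id,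
    Set.inter_comm] at h2

theorem continuous_toBW : Continuous (toBW : E → BWSpace E) :=
  continuous_of_continuousOn_isCompact fun _ hK =>
    continuousOn_of_isCompact hK (toWeakSpaceCLM ℝ E).continuous.continuousOn

instance [MeasurableSpace E] [BorelSpace E] : OpensMeasurableSpace (BWSpace E) where
  borel_le := MeasurableSpace.generateFrom_le fun s hs =>
    (continuous_toBW.isOpen_preimage s hs).measurableSet

theorem exists_norm_le {K : Set (BWSpace E)} (hK : IsCompact K) :
    ∃ R : ℝ, ∀ x ∈ K, ‖toBW.symm x‖ ≤ R := by
  obtain ⟨R, hR⟩ := (hK.image continuous_toWeak).exists_norm_le_of_weakSpace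
  exact ⟨R, fun x hx => hR _ (Set.mem_image_of_mem _ hx)⟩

theorem continuous_dual_apply (f : StrongDual ℝ E) :
    Continuous fun x : BWSpace E => f (toBW.symm x) :=
  (continuous_weakSpace_apply f).comp continuous_toWeak

theorem continuousOn_add {C K : Set (BWSpace E)} (hC : IsCompact C) (hK : IsCompact K) :
    ContinuousOn (fun p : BWSpace E × BWSpace E => p.1 + p.2) (C ×ˢ K) :=
  continuousOn_of_isCompact (hC.prod hK) <| Continuous.continuousOn <|
    (continuous_toWeak.comp continuous_fst).add (continuous_toWeak.comp continuous_snd)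

/-- With `g t = f ∘ T t`, the increment of `g t x` is `(g t' - g t) x' + g t (x' - x)`: the first
term is small uniformly on the bounded set `C`, the second by weak continuity of `g t`. -/
theorem continuousOn_orbit {T : ℝ≥0 → E →L[ℝ] E}
    (hT : ∀ f : StrongDual ℝ E, Continuous fun t => f.comp (T t)) (t₀ : ℝ≥0)
    {C : Set (BWSpace E)} (hC : IsCompact C) :
    ContinuousOn (fun p : ℝ≥0 × BWSpace E => toBW (T p.1 (toBW.symm p.2)))
      (Set.Iic t₀ ×ˢ C) := by
  rw [← Set.Icc_bot]
  refine continuousOn_of_isCompact (isCompact_Icc.prod hC) (continuousOn_weakSpace_iff.2 fun f => ?_)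
  obtain ⟨R, hR⟩ := exists_norm_le hC
  rintro ⟨t, x⟩ ⟨-, hx⟩
  set g : ℝ≥0 → StrongDual ℝ E := fun t => f.comp (T t)
  have hlim : Tendsto (fun p : ℝ≥0 × BWSpace E => ‖g p.1 - g t‖ * R +
      ‖g t (toBW.symm p.2) - g t (toBW.symm x)‖) (𝓝[Set.Icc ⊥ t₀ ×ˢ C] (t, x)) (𝓝 0) := by
    have hc : Continuous fun p : ℝ≥0 × BWSpace E => ‖g p.1 - g t‖ * R +
        ‖g t (toBW.symm p.2) - g t (toBW.symm x)‖ :=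
      ((((hT f).comp continuous_fst).sub continuous_const).norm.mul continuous_const).add
        (((continuous_dual_apply (g t)).comp continuous_snd).sub continuous_const).norm
    simpa using (hc.tendsto (t, x)).mono_left nhdsWithin_le_nhds
  rw [ContinuousWithinAt, tendsto_iff_norm_sub_tendsto_zero]
  refine squeeze_zero' (Eventually.of_forall fun _ => norm_nonneg _) ?_ hlim
  filter_upwards [self_mem_nhdsWithin] with p hp
  change ‖g p.1 (toBW.symm p.2) - g t (toBW.symm x)‖ ≤ _
  calc ‖g p.1 (toBW.symm p.2) - g t (toBW.symm x)‖
      = ‖(g p.1 - g t) (toBW.symm p.2) + (g t (toBW.symm p.2) - g t (toBW.symm x))‖ := by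
        rw [_root_.sub_apply]; abel_nf
    _ ≤ _ := (norm_add_le _ _).trans
      (add_le_add ((g p.1 - g t).le_opNorm_of_le (hR _ hp.2)) le_rfl)

end BWSpace

/-! ### The adjoint semigroup on the dual of a reflexive space -/

theorem exists_dual_eq_zero_of_isClosed {F : Type*} [NormedAddCommGroup F] [NormedSpace ℝ F]
    {D : Submodule ℝ F} (hD : IsClosed (D : Set F)) {x : F} (hx : x ∉ D) :
    ∃ f : StrongDual ℝ F, (∀ y ∈ D, f y = 0) ∧ f x ≠ 0 := by
  obtain ⟨f, u, hu, hux⟩ := geometric_hahn_banach_closed_point (D.convex) hD hx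
  have h0 : ∀ y ∈ D, f y = 0 := fun y hy => by
    by_contra hne
    -- The rescaled vector has value exactly `u`, contradicting the strict bound `f < u` on `D`.
    have := hu ((u / f y) • y) (D.smul_mem _ hy)
    rw [map_smul, smul_eq_mul, div_mul_cancel₀ _ hne] at this
    exact lt_irrefl _ this
  refine ⟨f, h0, ?_⟩
  have := hu 0 D.zero_mem
  rw [map_zero] at this
  exact (this.trans hux).ne'

namespace IsC0Semigroup

variable {E : Type*} [NormedAddCommGroup E] [NormedSpace ℝ E] [CompleteSpace E]
  {T : ℝ≥0 → E →L[ℝ] E}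

theorem continuous_apply_toNNReal (hT : IsC0Semigroup T) (x : E) :
    Continuous fun s : ℝ => T s.toNNReal x :=
  (hT.continuous_apply x).comp continuous_real_toNNReal

omit [CompleteSpace E] in
theorem norm_integral_le {h : ℝ} {M : ℝ}
    (hM : ∀ t ≤ h.toNNReal, ‖T t‖ ≤ M) {a b : ℝ} (ha : a ≤ h) (hb : b ≤ h) (x : E) :
    ‖∫ s in a..b, T s.toNNReal x‖ ≤ M * ‖x‖ * |b - a| := by
  refine intervalIntegral.norm_integral_le_of_norm_le_const fun s hs => ?_
  exact (T _).le_of_opNorm_le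
    (hM _ (Real.toNNReal_le_toNNReal (hs.2.trans (max_le ha hb)))) x

/-- The integrated semigroup `x ↦ ∫ s in 0..h, T s x`. -/
noncomputable def integrated (hT : IsC0Semigroup T) (h : ℝ≥0) : E →L[ℝ] E :=
  LinearMap.mkContinuous
    { toFun := fun x => ∫ s in (0 : ℝ)..h, T s.toNNReal x
      map_add' := fun x y => by
        simp only [_root_.map_add]
        exact intervalIntegral.integral_add
          ((hT.continuous_apply_toNNReal x).intervalIntegrable _ _)
          ((hT.continuous_apply_toNNReal y).intervalIntegrable _ _)
      map_smul' := fun c x => by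
        simp only [map_smul]
        exact intervalIntegral.integral_smul c _ }
    ((hT.exists_norm_le h).choose * h) fun x => by
      have := norm_integral_le (T := T) (h := h) (M := (hT.exists_norm_le h).choose)
        (by simpa using (hT.exists_norm_le h).choose_spec.2) (a := 0) (b := h)
        h.coe_nonneg le_rfl x
      rw [sub_zero, abs_of_nonneg h.coe_nonneg] at this
      exact this.trans_eq (by ring)

theorem integrated_apply (hT : IsC0Semigroup T) (h : ℝ≥0) (x : E) :
    hT.integrated h x = ∫ s in (0 : ℝ)..h, T s.toNNReal x :=
  rfl

/-- Composing with `T t` shifts the interval of integration by `t`, which changes only two end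
pieces of length `t`. The error is at most `2 * M * t` in operator norm, although `T` itself is only
strongly continuous. -/
theorem tendsto_integrated_comp (hT : IsC0Semigroup T) (h : ℝ≥0) :
    Tendsto (fun t => (hT.integrated h).comp (T t)) (𝓝 0) (𝓝 (hT.integrated h)) := by
  obtain ⟨M, hM1, hM⟩ := hT.exists_norm_le (h + 1)
  have hlim : Tendsto (fun t : ℝ≥0 => 2 * M * (t : ℝ)) (𝓝 0) (𝓝 0) := by
    have : Continuous fun t : ℝ≥0 => 2 * M * (t : ℝ) := by fun_prop
    simpa using this.tendsto 0
  rw [tendsto_iff_norm_sub_tendsto_zero]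
  refine squeeze_zero' (Eventually.of_forall fun _ => norm_nonneg _) ?_ hlim
  filter_upwards [Iic_mem_nhds one_pos] with t ht
  have ht' : (t : ℝ) ≤ 1 := ht
  refine ContinuousLinearMap.opNorm_le_bound _ (by positivity) fun x => ?_
  have hI := fun a b => (hT.continuous_apply_toNNReal x).intervalIntegrable (μ := volume) a b
  have h1 : hT.integrated h (T t x) = ∫ s in (t : ℝ)..(h + t), T s.toNNReal x := by
    have := intervalIntegral.integral_comp_add_right (fun s : ℝ => T s.toNNReal x) (t : ℝ)
      (a := 0) (b := h)
    rw [zero_add] at this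
    rw [← this, integrated_apply]
    refine intervalIntegral.integral_congr fun s hs => ?_
    rw [Set.uIcc_of_le h.coe_nonneg] at hs
    simp only [Real.toNNReal_add hs.1 t.coe_nonneg, Real.toNNReal_coe, hT.map_add]
    rfl
  have h2 : hT.integrated h (T t x) - hT.integrated h x =
      (∫ s in (h : ℝ)..(h + t), T s.toNNReal x) - ∫ s in (0 : ℝ)..t, T s.toNNReal x := by
    rw [h1, integrated_apply, intervalIntegral.integral_interval_sub_interval_comm' (hI _ _)
      (hI _ _) (hI _ _)]
  have hM' : ∀ s ≤ ((h : ℝ) + 1).toNNReal, ‖T s‖ ≤ M := fun s hs => hM s (by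
    rwa [Real.toNNReal_add h.coe_nonneg zero_le_one, Real.toNNReal_coe, Real.toNNReal_one] at hs)
  have hh := h.coe_nonneg
  have b1 := norm_integral_le (T := T) hM' (a := h) (b := h + t) (by linarith) (by linarith) x
  have b2 := norm_integral_le (T := T) hM' (a := 0) (b := t) (by linarith) (by linarith) x
  rw [add_sub_cancel_left, abs_of_nonneg t.coe_nonneg] at b1
  rw [sub_zero, abs_of_nonneg t.coe_nonneg] at b2
  change ‖hT.integrated h (T t x) - hT.integrated h x‖ ≤ _
  rw [h2]
  refine (_root_.norm_sub_le _ _).trans ((add_le_add b1 b2).trans_eq (by ring))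

/-- The right derivative of `r ↦ hT.integrated r x` at `0` is `T 0 x = x`. -/
theorem eq_zero_of_integrated_eq_zero (hT : IsC0Semigroup T) {x : E}
    (h : ∀ r, hT.integrated r x = 0) : x = 0 := by
  have hd := intervalIntegral.integral_hasDerivAt_right
    ((hT.continuous_apply_toNNReal x).intervalIntegrable (μ := volume) 0 0)
    (hT.continuous_apply_toNNReal x).stronglyMeasurable.stronglyMeasurableAtFilter
    (hT.continuous_apply_toNNReal x).continuousAt
  have hs := hd.tendsto_slope_zero_right
  rw [Real.toNNReal_zero, hT.map_zero] at hs
  refine tendsto_nhds_unique (hs.congr' ?_) tendsto_const_nhds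
  filter_upwards [self_mem_nhdsWithin] with r hr
  have := h r.toNNReal
  rw [integrated_apply, Real.coe_toNNReal _ (le_of_lt hr)] at this
  simp [this]

/-- The functionals on which the adjoint semigroup is strongly continuous. -/
def sunDual (T : ℝ≥0 → E →L[ℝ] E) : Submodule ℝ (StrongDual ℝ E) where
  carrier := {f | Tendsto (fun t => f.comp (T t)) (𝓝 0) (𝓝 f)}
  add_mem' {f g} hf hg := by
    change Tendsto (fun t => (f + g).comp (T t)) _ _
    simpa only [ContinuousLinearMap.add_comp] using Tendsto.add hf hg
  zero_mem' := by simp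
  smul_mem' c f hf := by
    change Tendsto (fun t => (c • f).comp (T t)) _ _
    simpa only [ContinuousLinearMap.smul_comp] using Tendsto.const_smul hf c

theorem isClosed_sunDual (hT : IsC0Semigroup T) :
    IsClosed (sunDual T : Set (StrongDual ℝ E)) := by
  obtain ⟨M, hM1, hM⟩ := hT.exists_norm_le 1
  refine isClosed_of_closure_subset fun f hf => ?_
  change Tendsto (fun t => f.comp (T t)) (𝓝 0) (𝓝 f)
  rw [Metric.tendsto_nhds]
  intro ε hε
  -- Replacing `f` by `g` costs `‖f - g‖ * M` after composition and `‖f - g‖` before, together less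
  -- than `ε / 2`.
  obtain ⟨g, hg, hfg⟩ := Metric.mem_closure_iff.1 hf (ε / (2 * (M + 1))) (by positivity)
  have hg' : Tendsto (fun t => g.comp (T t)) (𝓝 0) (𝓝 g) := hg
  filter_upwards [Metric.tendsto_nhds.1 hg' (ε / 2) (half_pos hε), Iic_mem_nhds one_pos] with t h1 ht
  rw [dist_eq_norm] at *
  have h2 : ‖(f - g).comp (T t)‖ ≤ ‖f - g‖ * M :=
    (ContinuousLinearMap.opNorm_comp_le _ _).trans (by gcongr; exact hM t ht)
  have h3 : f.comp (T t) - f = (f - g).comp (T t) + (g.comp (T t) - g) - (f - g) := by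
    rw [ContinuousLinearMap.sub_comp]; abel
  rw [lt_div_iff₀ (by positivity)] at hfg
  rw [h3]
  calc _ ≤ ‖f - g‖ * M + ‖g.comp (T t) - g‖ + ‖f - g‖ :=
        (_root_.norm_sub_le _ _).trans (by gcongr; exact (norm_add_le _ _).trans (by gcongr))
    _ < ε := by nlinarith

/-- The subspace is closed and contains every `g ∘ hT.integrated r`. By reflexivity a functional
annihilating it is evaluation at some `x`; then `g (hT.integrated r x) = 0` for all `g` and `r`, so
`x = 0`. -/
theorem sunDual_eq_top (hT : IsC0Semigroup T) (hE : IsReflexiveSpace E) : sunDual T = ⊤ := by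
  refine Submodule.eq_top_iff'.2 fun f => ?_
  by_contra hf
  obtain ⟨Φ, hΦ, hΦf⟩ := exists_dual_eq_zero_of_isClosed hT.isClosed_sunDual hf
  obtain ⟨x, rfl⟩ := hE Φ
  refine hΦf ?_
  rw [hT.eq_zero_of_integrated_eq_zero (x := x) fun r => ?_]
  · simp
  refine (SeparatingDual.eq_zero_iff_forall_dual_eq_zero (R := ℝ) _).2 fun g => ?_
  refine hΦ (g.comp (hT.integrated r)) ?_
  exact ((ContinuousLinearMap.compL ℝ E E ℝ g).continuous.tendsto _).comp
    (hT.tendsto_integrated_comp r)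

theorem continuous_dual_comp (hT : IsC0Semigroup T) (hE : IsReflexiveSpace E)
    (f : StrongDual ℝ E) : Continuous fun t => f.comp (T t) := by
  have hA : IsC0Semigroup fun t => (ContinuousLinearMap.compL ℝ E E ℝ).flip (T t) :=
    { map_zero := by ext; simp [hT.map_zero]
      map_add := fun s t => by ext; simp [add_comm s t, hT.map_add]
      tendsto_zero := fun g => (hT.sunDual_eq_top hE ▸ Submodule.mem_top : g ∈ sunDual T) }
  exact hA.continuous_apply f

end IsC0Semigroup

/-! ### Tightness for the bounded weak topology -/

theorem exists_dual_seq_norming (E : Type*) [NormedAddCommGroup E] [NormedSpace ℝ E]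
    [TopologicalSpace.SeparableSpace E] :
    ∃ f : ℕ → StrongDual ℝ E, (∀ k, ‖f k‖ ≤ 1) ∧ ∀ (r : ℝ) (y : E), r < ‖y‖ → ∃ k, r < f k y := by
  choose f hf hfx using fun k => exists_dual_vector'' ℝ (TopologicalSpace.denseSeq E k)
  refine ⟨f, hf, fun r y hy => ?_⟩
  -- Half of the gap is lost in comparing norms, half in moving the norming functional from the
  -- dense point to `y`.
  obtain ⟨k, hk⟩ := (TopologicalSpace.denseRange_denseSeq E).exists_dist_lt y
    (half_pos (sub_pos.2 hy))
  rw [dist_eq_norm] at hk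
  have h1 := (le_abs_self _).trans ((f k).le_of_opNorm_le (hf k)
    (TopologicalSpace.denseSeq E k - y))
  have h2 := norm_sub_norm_le y (TopologicalSpace.denseSeq E k)
  rw [map_sub, hfx, one_mul, norm_sub_rev] at h1
  simp only [RCLike.ofReal_real_eq_id, id_eq] at h1
  exact ⟨k, by linarith⟩

section Tight

variable {E : Type*} [NormedAddCommGroup E] [NormedSpace ℝ E]

/-- A weakly continuous approximation of the norm from below. -/
noncomputable def normApprox (f : ℕ → StrongDual ℝ E) (m : ℕ) (y : E) : ℝ≥0 :=
  (Finset.range m).sup fun k => (f k y).toNNReal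

theorem normApprox_le {f : ℕ → StrongDual ℝ E} (hf : ∀ k, ‖f k‖ ≤ 1) (m : ℕ) (y : E) :
    normApprox f m y ≤ ‖y‖₊ :=
  Finset.sup_le fun k _ => Real.toNNReal_le_iff_le_coe.2 <|
    (le_abs_self _).trans (((f k).le_of_opNorm_le (hf k) y).trans_eq (one_mul _))

theorem continuous_normApprox (f : ℕ → StrongDual ℝ E) (m : ℕ) :
    Continuous fun y : BWSpace E => normApprox f m (toBW.symm y) :=
  Continuous.finset_sup_apply fun k _ =>
    continuous_real_toNNReal.comp (BWSpace.continuous_dual_apply (f k))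

/-- A cutoff that vanishes where `‖y‖ ≤ n`. -/
noncomputable def normCutoff (f : ℕ → StrongDual ℝ E) (m : ℕ → ℕ) (n : ℕ) (y : E) : ℝ≥0 :=
  min 1 (normApprox f (m n) y - n)

theorem normCutoff_eq_zero {f : ℕ → StrongDual ℝ E} (hf : ∀ k, ‖f k‖ ≤ 1) (m : ℕ → ℕ) {n : ℕ}
    {y : E} (hy : ‖y‖ ≤ n) : normCutoff f m n y = 0 := by
  rw [normCutoff, tsub_eq_zero_of_le ((normApprox_le hf _ y).trans (by exact_mod_cast hy)),
    min_eq_right zero_le_one]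

/-- The supremum of the cutoffs of index at least `N`. -/
noncomputable def tailCutoff (f : ℕ → StrongDual ℝ E) (m : ℕ → ℕ) (N : ℕ) (y : E) : ℝ≥0 :=
  (Finset.Ico N ⌈‖y‖⌉₊).sup fun n => normCutoff f m n y

theorem tailCutoff_le_one (f : ℕ → StrongDual ℝ E) (m : ℕ → ℕ) (N : ℕ) (y : E) :
    tailCutoff f m N y ≤ 1 :=
  Finset.sup_le fun _ _ => min_le_left _ _

theorem normCutoff_le_tailCutoff {f : ℕ → StrongDual ℝ E} (hf : ∀ k, ‖f k‖ ≤ 1) (m : ℕ → ℕ)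
    {N n : ℕ} (hn : N ≤ n) (y : E) : normCutoff f m n y ≤ tailCutoff f m N y := by
  rcases le_or_gt ⌈‖y‖⌉₊ n with h | h
  · rw [normCutoff_eq_zero hf m (Nat.ceil_le.1 h)]
    exact zero_le
  · exact Finset.le_sup (f := fun n => normCutoff f m n y) (Finset.mem_Ico.2 ⟨hn, h⟩)

theorem tailCutoff_eq_zero (f : ℕ → StrongDual ℝ E) (m : ℕ → ℕ) {N : ℕ} {y : E}
    (hy : ‖y‖ ≤ N) : tailCutoff f m N y = 0 := by
  rw [tailCutoff, Finset.Ico_eq_empty_of_le (Nat.ceil_le.2 hy), Finset.sup_empty, bot_eq_zero]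

theorem tailCutoff_eq_sup {f : ℕ → StrongDual ℝ E} (hf : ∀ k, ‖f k‖ ≤ 1) (m : ℕ → ℕ)
    (N : ℕ) {M : ℕ} {y : E} (hy : ‖y‖ ≤ M) :
    tailCutoff f m N y = (Finset.Ico N M).sup fun n => normCutoff f m n y :=
  le_antisymm (Finset.sup_mono (Finset.Ico_subset_Ico_right (Nat.ceil_le.2 hy)))
    (Finset.sup_le fun _ hn => normCutoff_le_tailCutoff hf m (Finset.mem_Ico.1 hn).1 y)

/-- Compact sets are norm bounded, and on a bounded set only finitely many cutoffs are nonzero. The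
bounded weak topology enters here: continuity needs checking on compact sets only. -/
theorem continuous_tailCutoff {f : ℕ → StrongDual ℝ E} (hf : ∀ k, ‖f k‖ ≤ 1) (m : ℕ → ℕ)
    (N : ℕ) : Continuous fun y : BWSpace E => tailCutoff f m N (toBW.symm y) := by
  refine continuous_of_continuousOn_isCompact fun K hK => ?_
  obtain ⟨R, hR⟩ := BWSpace.exists_norm_le hK
  obtain ⟨M, hM⟩ := exists_nat_ge R
  have hc : Continuous fun y : BWSpace E =>
      (Finset.Ico N M).sup fun n => normCutoff f m n (toBW.symm y) :=
    Continuous.finset_sup_apply fun n _ =>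
      continuous_const.min ((continuous_normApprox f (m n)).sub continuous_const)
  exact hc.continuousOn.congr fun y hy => tailCutoff_eq_sup hf m N ((hR y hy).trans hM)

/-- `tailCutoff` as a bounded continuous function. -/
noncomputable def tailCutoffBCF {f : ℕ → StrongDual ℝ E} (hf : ∀ k, ‖f k‖ ≤ 1) (m : ℕ → ℕ)
    (N : ℕ) : BWSpace E →ᵇ ℝ :=
  BoundedContinuousFunction.ofNormedAddCommGroup
    (fun y => (tailCutoff f m N (toBW.symm y) : ℝ))
    (NNReal.continuous_coe.comp (continuous_tailCutoff hf m N)) 1 fun y => by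
      simpa using tailCutoff_le_one f m N (toBW.symm y)

variable [TopologicalSpace.SeparableSpace E] [MeasurableSpace E] [BorelSpace E]

/-- Suppose mass above `ε` escapes along times `t n`. A single tail cutoff then has integral at
least `ε` against `μ (t n)` for all `n ≥ N`, yet vanishes on the ball of radius `N`. At a limit
point `s` of the times, `μ s` gives every `{N < ‖y‖}` mass at least `ε`, which is impossible for a
finite measure. -/
theorem exists_measureReal_norm_gt_le {μ : ℝ≥0 → Measure E}
    (hμ : ∀ t, IsProbabilityMeasure (μ t))
    (hcont : ∀ φ : BWSpace E →ᵇ ℝ, Continuous fun t => ∫ y, φ (toBW y) ∂μ t) (t₀ : ℝ≥0)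
    {ε : ℝ} (hε : 0 < ε) : ∃ R : ℕ, ∀ t ≤ t₀, (μ t).real {y | (R : ℝ) < ‖y‖} ≤ ε := by
  by_contra! hcon
  obtain ⟨f, hf, hfn⟩ := exists_dual_seq_norming E
  -- Radius `n + 1` rather than `n`, so that the cutoff of index `n` has reached the value `1` where
  -- the approximate norm exceeds it.
  choose t ht htε using fun n : ℕ => hcon (n + 1)
  -- By continuity of measure from below, finitely many functionals already detect mass above `ε`.
  have hm : ∀ n, ∃ m, ε < (μ (t n)).real {y | ((n + 1 : ℕ) : ℝ≥0) < normApprox f m y} := by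
    intro n
    have hU : {y : E | ((n + 1 : ℕ) : ℝ) < ‖y‖} =
        ⋃ m, {y | ((n + 1 : ℕ) : ℝ≥0) < normApprox f m y} := by
      ext y
      simp only [Set.mem_ofPred_eq, Set.mem_iUnion]
      refine ⟨fun hy => ?_, fun ⟨m, hy⟩ => by exact_mod_cast hy.trans_le (normApprox_le hf m y)⟩
      obtain ⟨k, hk⟩ := hfn _ y hy
      refine ⟨k + 1, lt_of_lt_of_le ?_ (Finset.le_sup (f := fun k => (f k y).toNNReal)
        (Finset.self_mem_range_succ k))⟩
      rw [Real.lt_toNNReal_iff_coe_lt]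
      exact_mod_cast hk
    have hmono : Monotone fun m => {y : E | ((n + 1 : ℕ) : ℝ≥0) < normApprox f m y} :=
      fun a b hab => Set.ofPred_subset_ofPred.2 fun y hy =>
        hy.trans_le (Finset.sup_mono (Finset.range_mono hab))
    have h := htε n
    rw [hU, measureReal_def, ← ENNReal.ofReal_lt_iff_lt_toReal hε.le (measure_ne_top _ _),
      hmono.measure_iUnion, lt_iSup_iff] at h
    obtain ⟨m, hm⟩ := h
    exact ⟨m, (ENNReal.ofReal_lt_iff_lt_toReal hε.le (measure_ne_top _ _)).1 hm⟩
  choose m hm using hm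
  have hint : ∀ (N : ℕ) (s : ℝ≥0), Integrable (fun y => tailCutoffBCF hf m N (toBW y)) (μ s) :=
    fun N s => ((tailCutoffBCF hf m N).compContinuous
      ⟨toBW, BWSpace.continuous_toBW⟩).integrable (μ s)
  have hlow : ∀ N n, N ≤ n → ε ≤ ∫ y, tailCutoffBCF hf m N (toBW y) ∂μ (t n) := by
    intro N n hn
    have hS : MeasurableSet {y : E | ((n + 1 : ℕ) : ℝ≥0) < normApprox f (m n) y} :=
      (isOpen_lt continuous_const
        ((continuous_normApprox f (m n)).comp BWSpace.continuous_toBW)).measurableSet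
    refine (hm n).le.trans ?_
    rw [← integral_indicator_one hS]
    refine integral_mono ((integrable_const 1).indicator hS) (hint N _) fun y => ?_
    by_cases hy : ((n + 1 : ℕ) : ℝ≥0) < normApprox f (m n) y
    · rw [Set.indicator_of_mem (by exact hy)]
      have h1 : (1 : ℝ≥0) ≤ normCutoff f m n y := by
        refine le_min le_rfl (le_tsub_of_add_le_left ?_)
        exact_mod_cast hy.le
      exact_mod_cast h1.trans (normCutoff_le_tailCutoff hf m hn y)
    · rw [Set.indicator_of_notMem (by exact hy)]
      exact NNReal.coe_nonneg _
  have hup : ∀ (N : ℕ) (s : ℝ≥0), ∫ y, tailCutoffBCF hf m N (toBW y) ∂μ s ≤ (μ s).real {y | (N : ℝ) < ‖y‖} := by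
    intro N s
    have hS : MeasurableSet {y : E | (N : ℝ) < ‖y‖} :=
      (isOpen_lt continuous_const continuous_norm).measurableSet
    rw [← integral_indicator_one hS]
    refine integral_mono (hint N s) ((integrable_const 1).indicator hS) fun y => ?_
    by_cases hy : (N : ℝ) < ‖y‖
    · rw [Set.indicator_of_mem (by exact hy)]
      exact_mod_cast tailCutoff_le_one f m N y
    · rw [Set.indicator_of_notMem (by exact hy)]
      exact (NNReal.coe_eq_zero.2 (tailCutoff_eq_zero f m (not_lt.1 hy))).le
  obtain ⟨s, -, σ, hσ, hs⟩ := (isCompact_Icc (a := (0 : ℝ≥0)) (b := t₀)).tendsto_subseq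
    fun n => ⟨zero_le, ht n⟩
  have hN : ∀ N : ℕ, ε ≤ (μ s).real {y | (N : ℝ) < ‖y‖} := by
    intro N
    refine le_trans (ge_of_tendsto (((hcont (tailCutoffBCF hf m N)).tendsto s).comp hs) ?_)
      (hup N s)
    filter_upwards [eventually_ge_atTop N] with k hk
    exact hlow N (σ k) (hk.trans (hσ.le_apply))
  have hlim : Tendsto (fun N : ℕ => (μ s).real {y | (N : ℝ) < ‖y‖}) atTop (𝓝 0) := by
    have hanti : Antitone fun N : ℕ => {y : E | (N : ℝ) < ‖y‖} :=
      fun a b hab => Set.ofPred_subset_ofPred.2 fun y hy =>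
        lt_of_le_of_lt (Nat.cast_le.2 hab) hy
    have h := tendsto_measure_iInter_atTop (μ := μ s) (fun N : ℕ =>
      (isOpen_lt continuous_const continuous_norm : IsOpen {y : E | (N : ℝ) < ‖y‖})
        |>.measurableSet.nullMeasurableSet) hanti ⟨0, measure_ne_top _ _⟩
    have hempty : ⋂ N : ℕ, {y : E | (N : ℝ) < ‖y‖} = ∅ :=
      Set.eq_empty_of_forall_notMem fun y hy => by
        obtain ⟨N, hN⟩ := exists_nat_ge ‖y‖
        exact not_lt.2 hN (Set.mem_iInter.1 hy N)
    rw [hempty, measure_empty] at h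
    exact (ENNReal.tendsto_toReal ENNReal.zero_ne_top).comp h
  exact absurd (ge_of_tendsto' hlim hN) (not_le.2 hε)

end Tight

/-! ### Mehler semigroups for the bounded weak topology -/

theorem isMehlerFamily_bw {E : Type*} [NormedAddCommGroup E] [NormedSpace ℝ E] [CompleteSpace E]
    [TopologicalSpace.SeparableSpace E] [MeasurableSpace E] [BorelSpace E]
    (hE : IsReflexiveSpace E) {T : ℝ≥0 → E →L[ℝ] E} (hT : IsC0Semigroup T)
    {μ : ℝ≥0 → Measure E} (hμ : ∀ t, IsProbabilityMeasure (μ t))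
    (hconv : ∀ t s, μ (t + s) = ((μ t).map (T s)) ∗ μ s)
    (hcont : ∀ φ : BWSpace E →ᵇ ℝ, Continuous fun t => ∫ y, φ (toBW y) ∂μ t) :
    IsMehlerFamily (X := BWSpace E) (fun t x => toBW (T t (toBW.symm x))) μ where
  isProbabilityMeasure := hμ
  map_zero x := by rw [hT.map_zero]; rfl
  map_add s t x := by rw [hT.map_add]; rfl
  map_add_vec t x y := _root_.map_add (T t) (toBW.symm x) (toBW.symm y)
  measure_zero φ := by
    have h := measure_zero_eq_dirac hT hμ hconv
    have h1 : ∫ y, φ (toBW y) ∂μ 0 = φ 0 := by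
      rw [h, integral_dirac]
      rfl
    exact h1
  continuousOn_add _ _ := BWSpace.continuousOn_add
  continuousOn_orbit t₀ _ := BWSpace.continuousOn_orbit (hT.continuous_dual_comp hE) t₀
  tight t₀ ε hε := by
    obtain ⟨R, hR⟩ := exists_measureReal_norm_gt_le hμ hcont t₀ hε
    obtain ⟨K, hK, hKR⟩ := hE.exists_isCompact_weakSpace (R : ℝ)
    refine ⟨BWSpace.toWeak.symm '' K, BWSpace.isCompact_image_symm hK, fun t ht => ?_⟩
    have := hμ t
    refine le_trans ?_ (hR t ht)
    refine measureReal_mono (μ := μ t) (s₁ := toBW ⁻¹' (BWSpace.toWeak.symm '' K)ᶜ) fun y hy => ?_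
    exact not_le.1 fun hle => hy ⟨_, hKR y hle, rfl⟩
  continuous_integral := hcont
  integral_add s t φ := by
    have := integral_map_conv (μ := μ s) (ν := μ t) (T t)
      (φ.compContinuous ⟨toBW, BWSpace.continuous_toBW⟩)
    rw [← hconv] at this
    exact this

theorem mainTheorem10 {E : Type*} [NormedAddCommGroup E] [NormedSpace ℝ E] [CompleteSpace E]
    [TopologicalSpace.SeparableSpace E] [MeasurableSpace E] [BorelSpace E]
    (T : ℝ≥0 → E →L[ℝ] E) (hT : IsC0Semigroup T)
    (μ : ℝ≥0 → Measure E) (hμ : ∀ t, IsProbabilityMeasure (μ t))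
    (hconv : ∀ t s, μ (t + s) = ((μ t).map (T s)) ∗ μ s) :
    ((∀ φ : E →ᵇ ℝ, Continuous fun t => ∫ y, φ y ∂μ t) →
      ∃ P : ℝ≥0 → (E →ᵇ ℝ) →ₗ[ℝ] (E →ᵇ ℝ),
        (∀ t φ x, P t φ x = ∫ y, φ (T t x + y) ∂μ t) ∧
        IsMixedC0Semigroup fun t => ⇑(P t)) ∧
    (IsReflexiveSpace E →
      (∀ φ : BWSpace E →ᵇ ℝ, Continuous fun t => ∫ y, φ (toBW y) ∂μ t) →
      ∃ P : ℝ≥0 → (BWSpace E →ᵇ ℝ) →ₗ[ℝ] (BWSpace E →ᵇ ℝ),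
        (∀ t φ x, P t φ (toBW x) = ∫ y, φ (toBW (T t x + y)) ∂μ t) ∧
        IsMixedC0Semigroup fun t => ⇑(P t)) := by
  refine ⟨fun hcont => ?_, fun hE hcont => ?_⟩
  · have h := isMehlerFamily_norm hT hμ hconv hcont
    exact ⟨h.operator, h.operator_apply, h.isMixedC0Semigroup⟩
  · have h := isMehlerFamily_bw hE hT hμ hconv hcont
    exact ⟨h.operator, fun t φ x => h.operator_apply t φ (toBW x), h.isMixedC0Semigroup⟩
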